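/- Fix $d\ge 2$ and the Hilbert space $\mathcal H=\mathbb C^d$ with its computational basis, let $m$ be a non-negative integer, and for a unit vector $|\psi\rangle=\sum_i\psi_i|i\rangle$ write $|\psi^*\rangle=\sum_i\overline{\psi_i}|i\rangle$. Let $\mathcal S(\mathcal H)$ be the set of density operators on $\mathcal H$. A state transformation $T:\mathcal S(\mathcal H)\to\mathcal S(\mathcal H)$ is called probabilistically implementable from $m$ clones if there are $\epsilon>0$ and a quantum instrument $\{\mathcal E,\mathcal E'\}$ from $\mathcal H^{\otimes m}$ to $\mathcal H$ (i.e. completely positive linear maps $\mathcal E,\mathcal E':\mathcal B(\mathcal H^{\otimes m})\to\mathcal B(\mathcal H)$ with $\mathcal E+\mathcal E'$ trace preserving) such that, for every unit vector $|\psi\rangle\in\mathcal H$, $\mathcal E(|\psi\rangle\langle\psi|^{\otimes m})$ is a scalar multiple of $T(|\psi\rangle\langle\psi|)$ and $\operatorname{Tr}\,\mathcal E(|\psi\rangle\langle\psi|^{\otimes m})\ge\epsilon$. Theorem. For every $d\ge2$ and every $m$, state conjugation $\rho\mapsto\rho^*$ (entrywise complex conjugation in the computational basis, so that $|\psi\rangle\langle\psi|\mapsto|\psi^*\rangle\langle\psi^*|$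 on pure states) is not probabilistically implementable from $m$ clones. -/

import Mathlib

open scoped CStarAlgebra ComplexOrder

noncomputable section

/-- The C⋆-algebra `B(ℂ^ι)` of operators on the Hilbert space with orthonormal basis indexed
by the finite type `ι`, written as matrices in that (computational) basis. -/
abbrev Op (ι : Type) [Fintype ι] [DecidableEq ι] : Type := CStarMatrix ι ι ℂ

/-- The trace of an operator. -/
def Op.tr {ι : Type} [Fintype ι] [DecidableEq ι] (X : Op ι) : ℂ := ∑ i, X i i

/-- The set of states (density operators) on `ℂ^d`: positive operators of trace one. -/
def State (d : ℕ) : Type := {ρ : Op (Fin d) // 0 ≤ ρ ∧ ρ.tr = 1}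

/-- The operator `|ψ⟩⟨ψ|`, with matrix entries `ψ i * conj (ψ j)`. -/
def ketbra {d : ℕ} (ψ : EuclideanSpace ℂ (Fin d)) : Op (Fin d) :=
  CStarMatrix.ofMatrix (Matrix.of fun i j => ψ i * star (ψ j))

theorem ketbra_nonneg {d : ℕ} (ψ : EuclideanSpace ℂ (Fin d)) : 0 ≤ ketbra ψ := by
  have h : ketbra ψ = star (CStarMatrix.ofMatrix (Matrix.of fun (i j : Fin d) =>
      if i.val = 0 then star (ψ j) else 0) : Op (Fin d)) *
      (CStarMatrix.ofMatrix (Matrix.of fun (i j : Fin d) =>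
      if i.val = 0 then star (ψ j) else 0) : Op (Fin d)) := by
    ext i j
    have hd : 0 < d := i.pos
    rw [CStarMatrix.mul_apply, Finset.sum_eq_single (⟨0, hd⟩ : Fin d)]
    · simp [ketbra, CStarMatrix.star_apply]
    · intro k _ hk
      have : k.val ≠ 0 := fun h0 => hk (Fin.ext h0)
      simp [this]
    · simp
  rw [h]
  exact star_mul_self_nonneg _

theorem ketbra_tr {d : ℕ} (ψ : EuclideanSpace ℂ (Fin d)) (hψ : ‖ψ‖ = 1) : (ketbra ψ).tr = 1 := by
  have h := EuclideanSpace.norm_sq_eq ψ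
  have h2 : (ketbra ψ).tr = ((∑ i, ‖ψ i‖ ^ 2 : ℝ) : ℂ) := by
    simp [Op.tr, ketbra, Complex.mul_conj, Complex.normSq_eq_norm_sq]
  rw [h2, ← h, hψ]
  simp

/-- The pure state `|ψ⟩⟨ψ|` of a unit vector `ψ`. -/
def State.pure {d : ℕ} (ψ : EuclideanSpace ℂ (Fin d)) (hψ : ‖ψ‖ = 1) : State d :=
  ⟨ketbra ψ, ketbra_nonneg ψ, ketbra_tr ψ hψ⟩

/-- The tensor power `X^{⊗ m}` of an operator `X` on `ℂ^d`, acting on `(ℂ^d)^{⊗ m}`, whose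
orthonormal product basis is indexed by the functions `Fin m → Fin d`. -/
def tensorPow {d : ℕ} (m : ℕ) (X : Op (Fin d)) : Op (Fin m → Fin d) :=
  CStarMatrix.ofMatrix (Matrix.of fun i j => ∏ k, X (i k) (j k))

/-- A two-outcome quantum instrument `{E, E'}` from `B(ℂ^ι)` to `B(ℂ^κ)`: two completely positive
maps whose sum is trace preserving. -/
structure Instrument (ι κ : Type) [Fintype ι] [DecidableEq ι] [Fintype κ] [DecidableEq κ] where
  success : Op ι →CP Op κ
  failure : Op ι →CP Op κ
  tracePreserving : ∀ X : Op ι, (success X + failure X).tr = X.tr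

/-- A state transformation `T` is probabilistically implementable from `m` clones if some
instrument, for every pure input state `|ψ⟩⟨ψ|^{⊗ m}`, outputs in its success branch (a multiple
of) `T(|ψ⟩⟨ψ|)`, with success probability at least some `ε > 0` independent of `ψ`. -/
def ProbabilisticallyImplementable {d : ℕ} (T : State d → State d) (m : ℕ) : Prop :=
  ∃ ε : ℝ, 0 < ε ∧ ∃ I : Instrument (Fin m → Fin d) (Fin d),
    ∀ (ψ : EuclideanSpace ℂ (Fin d)) (hψ : ‖ψ‖ = 1),
      (∃ c : ℂ, I.success (tensorPow m (State.pure ψ hψ).1) = c • (T (State.pure ψ hψ)).1) ∧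
      ε ≤ (I.success (tensorPow m (State.pure ψ hψ).1)).tr.re

/-- Entrywise complex conjugation of an operator in the computational basis. -/
def Op.conj {ι : Type} [Fintype ι] [DecidableEq ι] (X : Op ι) : Op ι := X.map star

theorem Op.conj_nonneg {ι : Type} [Fintype ι] [DecidableEq ι] {X : Op ι} (hX : 0 ≤ X) :
    0 ≤ X.conj := by
  rw [StarOrderedRing.nonneg_iff] at hX ⊢
  induction hX using AddSubmonoid.closure_induction with
  | mem x hx =>
    obtain ⟨y, rfl⟩ := hx
    refine AddSubmonoid.subset_closure ⟨y.conj, ?_⟩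
    ext i j
    simp [Op.conj, CStarMatrix.mul_apply, CStarMatrix.star_apply]
  | zero =>
    have h : (0 : Op ι).conj = 0 := by ext i j; simp [Op.conj]
    rw [h]
    exact zero_mem _
  | add x y _ _ hx hy =>
    have h : (x + y).conj = x.conj + y.conj := by ext i j; simp [Op.conj]
    rw [h]
    exact add_mem hx hy

/-- State conjugation `ρ ↦ ρ*` with respect to the computational basis. -/
def State.conj {d : ℕ} (ρ : State d) : State d :=
  ⟨ρ.1.conj, Op.conj_nonneg ρ.2.1, by
    have h : ρ.1.conj.tr = star ρ.1.tr := by simp [Op.tr, Op.conj]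
    rw [h, ρ.2.2, star_one]⟩

/-- The vector `|ψ*⟩` with complex conjugate coordinates. -/
def conjVec {d : ℕ} (ψ : EuclideanSpace ℂ (Fin d)) : EuclideanSpace ℂ (Fin d) :=
  WithLp.toLp 2 fun i => star (ψ i)

theorem norm_conjVec {d : ℕ} (ψ : EuclideanSpace ℂ (Fin d)) : ‖conjVec ψ‖ = ‖ψ‖ := by
  simp [EuclideanSpace.norm_eq, conjVec]

/-- On pure states, state conjugation is `|ψ⟩⟨ψ| ↦ |ψ*⟩⟨ψ*|`. -/
theorem State.conj_pure {d : ℕ} (ψ : EuclideanSpace ℂ (Fin d)) (hψ : ‖ψ‖ = 1) :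
    (State.pure ψ hψ).conj = State.pure (conjVec ψ) ((norm_conjVec ψ).trans hψ) := by
  apply Subtype.ext
  ext i j
  simp [State.conj, State.pure, Op.conj, ketbra, conjVec]

end

/-!
A completely positive map `E` with `E(a⋆a) x = 0` also satisfies `x⋆ E(a⋆b) = 0` for every `b`,
by positivity of the image of the Gram block matrix of `a` and `b`. Hence, if
`E(|ψ⟩⟨ψ|^{⊗ m})` is always a multiple of `|ψ*⟩⟨ψ*|`, then the columns of `E(|ψ^{⊗ m}⟩⟨w|)` are
multiples of `ψ*`, for every fixed vector `w`. Along the line `ψ + t e_j` these columns are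
holomorphic in `t`, while the direction `ψ* + t̄ e_j` is antiholomorphic. Since `t ↦ t̄` is
nowhere complex differentiable, the columns vanish, so `E` never succeeds.
-/

section CStarAlgebra

-- For `CStarMatrix n n A`, instance search does not find the real functional calculus that
-- `CStarAlgebra.nonneg_iff_eq_star_mul_self` asks for; over a type variable it does.
theorem exists_eq_star_mul_self_of_nonneg {A : Type*} [NonUnitalCStarAlgebra A] [PartialOrder A]
    [StarOrderedRing A] {a : A} (ha : 0 ≤ a) : ∃ b, a = star b * b :=
  CStarAlgebra.nonneg_iff_eq_star_mul_self.mp ha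

variable {n A B : Type*} [Fintype n] [NonUnitalCStarAlgebra A] [PartialOrder A]
  [StarOrderedRing A] [NonUnitalCStarAlgebra B] [PartialOrder B] [StarOrderedRing B]

theorem cstarMatrix_gram_nonneg [Nonempty n] (a : n → A) :
    0 ≤ (CStarMatrix.ofMatrix (Matrix.of fun i j => star (a i) * a j) : CStarMatrix n n A) := by
  classical
  obtain ⟨k₀⟩ := ‹Nonempty n›
  let R : CStarMatrix n n A :=
    CStarMatrix.ofMatrix (Matrix.of fun k j => if k = k₀ then a j else 0)
  have hR : CStarMatrix.ofMatrix (Matrix.of fun i j => star (a i) * a j) = star R * R := by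
    ext i j
    rw [CStarMatrix.mul_apply, Finset.sum_eq_single k₀]
    · simp [R, CStarMatrix.star_apply]
    · intro k _ hk
      simp [R, hk]
    · simp
  exact hR ▸ star_mul_self_nonneg R

theorem star_mul_apply_eq_zero_of_apply_self_mul_eq_zero {M : CStarMatrix n n A} (hM : 0 ≤ M)
    {i : n} {x : A} (hx : M i i * x = 0) (j : n) : star x * M i j = 0 := by
  obtain ⟨Y, rfl⟩ := exists_eq_star_mul_self_of_nonneg hM
  have sum_eq_zero : ∑ k, star (Y k i * x) * (Y k i * x) = 0 :=
    calc
      _ = star x * ((star Y * Y) i i * x) := by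
        simp only [CStarMatrix.mul_apply, CStarMatrix.star_apply, Finset.mul_sum, Finset.sum_mul,
          star_mul, mul_assoc]
      _ = 0 := by rw [hx, mul_zero]
  have column_mul_eq_zero (k : n) : Y k i * x = 0 :=
    (CStarRing.star_mul_self_eq_zero_iff _).mp <|
      (Finset.sum_eq_zero_iff_of_nonneg fun k _ => star_mul_self_nonneg (Y k i * x)).mp
        sum_eq_zero k (Finset.mem_univ k)
  simp only [CStarMatrix.mul_apply, CStarMatrix.star_apply, Finset.mul_sum, ← mul_assoc,
    ← star_mul, column_mul_eq_zero, star_zero, zero_mul, Finset.sum_const_zero]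

theorem star_mul_map_star_mul_eq_zero (E : A →CP B) {a : A} {x : B}
    (hx : E (star a * a) * x = 0) (b : A) : star x * E (star a * b) = 0 :=
  star_mul_apply_eq_zero_of_apply_self_mul_eq_zero
    (E.map_cstarMatrix_nonneg _ (cstarMatrix_gram_nonneg ![a, b])) (i := 0) hx 1

end CStarAlgebra

section Holomorphic

open scoped ComplexConjugate

theorem not_differentiableAt_complex_conj (z : ℂ) :
    ¬ DifferentiableAt ℂ (fun t : ℂ => conj t) z := by
  intro h
  let D := fderiv ℂ (fun t : ℂ => conj t) z
  have hD (v : ℂ) : conj v = D v :=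
    DFunLike.congr_fun (Complex.conjCLE.hasFDerivAt.unique (h.hasFDerivAt.restrictScalars ℝ)) v
  have hlinear : D Complex.I = Complex.I * D 1 := by
    rw [← smul_eq_mul, ← map_smul, smul_eq_mul, mul_one]
  rw [← hD, ← hD, Complex.conj_I, map_one, mul_one, neg_eq_self] at hlinear
  exact Complex.I_ne_zero hlinear

theorem eq_zero_of_eq_conj_mul {f g : ℂ → ℂ} {z : ℂ} (hf : DifferentiableAt ℂ f z)
    (hg : DifferentiableAt ℂ g z) (h : ∀ t, g t = conj t * f t) : f z = 0 := by
  by_contra hz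
  refine not_differentiableAt_complex_conj z ((hg.div hf hz).congr_of_eventuallyEq ?_)
  filter_upwards [hf.continuousAt.eventually_ne hz] with t ht
  simp [h, ht]

end Holomorphic

section Outer

variable {ι κ : Type} [Fintype ι] [DecidableEq ι] [Fintype κ] [DecidableEq κ]

/-- The rank-one operator `|u⟩⟨w|` of two coordinate vectors, extending `ketbra` to pairs; it is
conjugate-linear in `w`. -/
def Op.outer (u w : ι → ℂ) : Op ι := CStarMatrix.ofMatrix (Matrix.vecMulVec u (star w))

theorem Op.outer_apply (u w : ι → ℂ) (i j : ι) : Op.outer u w i j = u i * star (w j) := rfl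

theorem Op.outer_smul_self (c : ℂ) (u : ι → ℂ) :
    Op.outer (c • u) (c • u) = (c * star c) • Op.outer u u := by
  ext i j
  simp only [Op.outer_apply, Pi.smul_apply, smul_eq_mul, star_mul', CStarMatrix.smul_apply]
  ring

theorem Op.star_outer (u w : ι → ℂ) : star (Op.outer u w) = Op.outer w u := by
  ext i j
  simp [Op.outer_apply, CStarMatrix.star_apply, mul_comm]

theorem Op.conj_outer (u w : ι → ℂ) : (Op.outer u w).conj = Op.outer (star u) (star w) := by
  ext i j
  simp [Op.conj, Op.outer_apply]

theorem Op.outer_mul_apply (u w : ι → ℂ) (X : Op ι) (i j : ι) :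
    (Op.outer u w * X) i j = u i * (star w ⬝ᵥ fun k => X k j) := by
  simp [CStarMatrix.mul_apply, Op.outer_apply, dotProduct, Finset.mul_sum, mul_assoc]

theorem Op.outer_mul_outer (u v w y : ι → ℂ) :
    Op.outer u v * Op.outer w y = (star v ⬝ᵥ w) • Op.outer u y := by
  ext i j
  simp only [Op.outer_mul_apply, Op.outer_apply, CStarMatrix.smul_apply, smul_eq_mul, dotProduct,
    Finset.mul_sum, Finset.sum_mul]
  exact Finset.sum_congr rfl fun k _ => by ring

theorem Op.differentiable_map_outer_left (L : Op ι →ₗ[ℂ] Op κ) (w : ι → ℂ) (i j : κ) :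
    Differentiable ℂ fun u => L (Op.outer u w) i j := by
  let entry : (ι → ℂ) →ₗ[ℂ] ℂ :=
    { toFun u := L (Op.outer u w) i j
      map_add' u v := by
        have h : Op.outer (u + v) w = Op.outer u w + Op.outer v w := by
          ext; simp [Op.outer_apply, add_mul]
        simp [h]
      map_smul' c u := by
        have h : Op.outer (c • u) w = c • Op.outer u w := by
          ext; simp [Op.outer_apply, mul_assoc]
        simp [h] }
  exact entry.toContinuousLinearMap.differentiable

theorem map_outer_apply_proportional [Nonempty ι] (E : Op ι →CP Op κ) {u : ι → ℂ} {φ : κ → ℂ}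
    {c : ℂ} (h : E (Op.outer u u) = c • Op.outer φ φ) (w : ι → ℂ) (i j r : κ) :
    φ j * E (Op.outer u w) i r = φ i * E (Op.outer u w) j r := by
  obtain ⟨e⟩ := ‹Nonempty ι›
  let v : κ → ℂ := Pi.single i (star (φ j)) - Pi.single j (star (φ i))
  have outer_eq (w : ι → ℂ) :
      star (Op.outer (Pi.single e 1) u) * Op.outer (Pi.single e 1) w = Op.outer u w := by
    simp [Op.star_outer, Op.outer_mul_outer]
  have orthogonal : star φ ⬝ᵥ v = 0 := by
    simp [v, dotProduct_sub, mul_comm]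
  have annihilates : E (Op.outer u u) * Op.outer v 1 = 0 := by
    rw [h, smul_mul_assoc, Op.outer_mul_outer, orthogonal, zero_smul, smul_zero]
  have row_eq_zero : star (Op.outer v 1) * E (Op.outer u w) = 0 := by
    rw [← outer_eq u] at annihilates
    simpa only [outer_eq] using
      star_mul_map_star_mul_eq_zero E annihilates (Op.outer (Pi.single e 1) w)
  have entry_eq_zero : (star (Op.outer v 1) * E (Op.outer u w)) r r = 0 := by
    rw [row_eq_zero, CStarMatrix.zero_apply]
  rw [Op.star_outer, Op.outer_mul_apply] at entry_eq_zero
  simpa [v, Pi.star_single, sub_dotProduct, sub_eq_zero] using entry_eq_zero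

end Outer

section TensorVec

/-- The tensor power `ψ^{⊗ m}` of a vector, by its coordinates in the product basis that indexes
`tensorPow`. -/
def tensorVec {ι : Type*} (m : ℕ) (ψ : ι → ℂ) (a : Fin m → ι) : ℂ := ∏ k, ψ (a k)

theorem differentiable_tensorVec {ι : Type*} [Finite ι] (m : ℕ) :
    Differentiable ℂ (tensorVec m : (ι → ℂ) → (Fin m → ι) → ℂ) := by
  cases nonempty_fintype ι
  unfold tensorVec
  fun_prop

theorem ketbra_eq_outer {d : ℕ} (ψ : EuclideanSpace ℂ (Fin d)) :
    ketbra ψ = Op.outer ψ.ofLp ψ.ofLp := rfl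

theorem tensorPow_outer {d : ℕ} (m : ℕ) (u w : Fin d → ℂ) :
    tensorPow m (Op.outer u w) = Op.outer (tensorVec m u) (tensorVec m w) := by
  ext a b
  simp [tensorPow, Op.outer_apply, tensorVec, Finset.prod_mul_distrib]

theorem tensorPow_smul {d : ℕ} (m : ℕ) (c : ℂ) (X : Op (Fin d)) :
    tensorPow m (c • X) = c ^ m • tensorPow m X := by
  ext a b
  simp [tensorPow, Finset.prod_mul_distrib]

theorem map_outer_tensorVec_eq_zero {ι : Type} [Fintype ι] [DecidableEq ι] [Nontrivial ι] {m : ℕ}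
    (E : Op (Fin m → ι) →CP Op ι)
    (hE : ∀ ψ : ι → ℂ, ψ ≠ 0 → ∃ c : ℂ,
      E (Op.outer (tensorVec m ψ) (tensorVec m ψ)) = c • Op.outer (star ψ) (star ψ))
    {ψ : ι → ℂ} (hψ : ψ ≠ 0) (w : (Fin m → ι) → ℂ) :
    E (Op.outer (tensorVec m ψ) w) = 0 := by
  obtain ⟨i, hi⟩ := Function.ne_iff.mp hψ
  obtain ⟨j, hji⟩ := exists_ne i
  let line (t : ℂ) : ι → ℂ := ψ + t • Pi.single j 1
  let F (t : ℂ) : Op ι := E (Op.outer (tensorVec m (line t)) w)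
  have line_i (t : ℂ) : line t i = ψ i := by simp [line, hji.symm]
  have line_j (t : ℂ) : line t j = ψ j + t := by simp [line]
  have line_zero : line 0 = ψ := by simp [line]
  have line_ne_zero (t : ℂ) : line t ≠ 0 := fun h => hi <| by simpa [h] using (line_i t).symm
  have differentiable_F (k r : ι) : Differentiable ℂ fun t => F t k r :=
    ((Op.differentiable_map_outer_left E.toLinearMap w k r).comp
      (differentiable_tensorVec m)).comp (by fun_prop)
  have proportional (t : ℂ) (k r : ι) : star (line t k) * F t i r = star (ψ i) * F t k r := by
    obtain ⟨c, hc⟩ := hE (line t) (line_ne_zero t)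
    simpa [line_i] using map_outer_apply_proportional E hc w i k r
  have F_i_eq_zero (r : ι) : F 0 i r = 0 := by
    refine eq_zero_of_eq_conj_mul (differentiable_F i r 0)
      (g := fun t => star (ψ i) * F t j r - star (ψ j) * F t i r)
      (((differentiable_F j r 0).const_mul _).sub ((differentiable_F i r 0).const_mul _))
      fun t => ?_
    rw [← proportional t j r, line_j, star_add, starRingEnd_apply]
    ring
  have F_eq_zero : F 0 = 0 := by
    ext k r
    simpa [F_i_eq_zero, show ψ i ≠ 0 from hi] using (proportional 0 k r).symm
  simpa only [F, line_zero] using F_eq_zero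

end TensorVec

section Conjugation

variable {d m : ℕ}

theorem map_tensorPow_ketbra_eq_smul_conj_of_unit
    (L : Op (Fin m → Fin d) →ₗ[ℂ] Op (Fin d))
    (hL : ∀ ψ : EuclideanSpace ℂ (Fin d), ‖ψ‖ = 1 →
      ∃ c : ℂ, L (tensorPow m (ketbra ψ)) = c • (ketbra ψ).conj)
    {ψ : EuclideanSpace ℂ (Fin d)} (hψ : ψ ≠ 0) :
    ∃ c : ℂ, L (tensorPow m (ketbra ψ)) = c • (ketbra ψ).conj := by
  obtain ⟨a, φ, ha, hφ, rfl⟩ : ∃ (a : ℂ) (φ : EuclideanSpace ℂ (Fin d)),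
      a ≠ 0 ∧ ‖φ‖ = 1 ∧ ψ = a • φ :=
    have hnorm : (‖ψ‖ : ℂ) ≠ 0 := by simpa using hψ
    ⟨‖ψ‖, (‖ψ‖ : ℂ)⁻¹ • ψ, hnorm, norm_smul_inv_norm hψ, (smul_inv_smul₀ hnorm ψ).symm⟩
  obtain ⟨c, hc⟩ := hL φ hφ
  have ketbra_smul : ketbra (a • φ) = (a * star a) • ketbra φ := Op.outer_smul_self a φ.ofLp
  have conj_smul : ((a * star a) • ketbra φ).conj = (a * star a) • (ketbra φ).conj := by
    ext i j
    simp [Op.conj, mul_comm]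
  have scale_ne_zero : a * star a ≠ 0 := mul_ne_zero ha (star_ne_zero.mpr ha)
  refine ⟨(a * star a) ^ m * c * (a * star a)⁻¹, ?_⟩
  rw [ketbra_smul, tensorPow_smul, map_smul, hc, conj_smul, smul_smul, smul_smul,
    inv_mul_cancel_right₀ scale_ne_zero]

theorem theorem1_general (hd : 2 ≤ d) (E : Op (Fin m → Fin d) →CP Op (Fin d))
    (hE : ∀ (ψ : EuclideanSpace ℂ (Fin d)) (hψ : ‖ψ‖ = 1),
      ∃ c : ℂ, E (tensorPow m (State.pure ψ hψ).1) = c • (State.pure ψ hψ).conj.1)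
    (ψ : EuclideanSpace ℂ (Fin d)) (hψ : ‖ψ‖ = 1) :
    E (tensorPow m (State.pure ψ hψ).1) = 0 := by
  have : Nontrivial (Fin d) := Fin.nontrivial_iff_two_le.mpr hd
  have proportional (φ : Fin d → ℂ) (hφ : φ ≠ 0) : ∃ c : ℂ,
      E (Op.outer (tensorVec m φ) (tensorVec m φ)) = c • Op.outer (star φ) (star φ) := by
    simpa [ketbra_eq_outer, tensorPow_outer, Op.conj_outer] using!
      map_tensorPow_ketbra_eq_smul_conj_of_unit E.toLinearMap hE
        (ψ := WithLp.toLp 2 φ) (by simpa using hφ)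
  have ψ_ne_zero : ψ.ofLp ≠ 0 := by
    simpa using (norm_ne_zero_iff (a := ψ)).mp (by simp [hψ])
  change E (tensorPow m (ketbra ψ)) = 0
  rw [ketbra_eq_outer, tensorPow_outer]
  exact map_outer_tensorVec_eq_zero E proportional ψ_ne_zero _

end Conjugation

theorem theorem1 (d : ℕ) (hd : 2 ≤ d) (m : ℕ) :
    ¬ ProbabilisticallyImplementable (State.conj : State d → State d) m := by
  rintro ⟨ε, hε, I, hI⟩
  obtain ⟨-, h⟩ := hI (EuclideanSpace.single ⟨0, by omega⟩ 1) (by simp)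
  rw [theorem1_general hd I.success fun ψ hψ => (hI ψ hψ).1] at h
  exact hε.not_ge (by simpa [Op.tr] using h)
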